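/- Let $f=(f_n)_{n\in\mathbb N}$ be an arbitrary family of Boolean functions $f_n:\{0,1\}^n\times\{0,1\}^n\to\{0,1\}$, and for $x\in\{0,1\}^n$ let $Y_1(x)=\{y\in\{0,1\}^n : f_n(x,y)=1\}$. *Communication.* In a one-sided non-deterministic protocol $P$ for $f_n$ with output set $\{1,\bot\}$, Alice knows $x$ and Bob knows $y$; they receive a guess $w=(w_A,w_B)$, of which $w_A$ is given to Alice only and $w_B$ to Bob only, and they exchange bits, each bit being an arbitrary function of what its sender knows (own input, own part of the guess, bits exchanged so far); the output $P(w,x,y)\in\{1,\bot\}$ is determined by the conversation $c(w)$. It is required that if $f_n(x,y)=1$ then $P(w,x,y)=1$ for some $w$, and if $f_n(x,y)\ne1$ then $P(w,x,y)=\bot$ for all $w$. Then $N^1(f_n)=\min_P\ \max_{(x,y):f_n(x,y)=1}\ \min\{|c(w)| : P(w,x,y)=1\}$ (the maximum over the empty set being $0$). *Programs.* Programs are binary words for a fixed universal machine that counts its steps and has an oracle. The oracle, asked for a number $m$, returns the truth table of $f_m$ in one step. A program is a self-delimiting code followed by an arbitrary word of data, and $|p|$ is the length in bits of the whole word. For a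 time bound $t:\mathbb N\to\mathbb N$, $A\subseteq\{0,1\}^n$ and $y\in\{0,1\}^n$, $\mathrm{ic}_{\mathrm{yes}}^{f,t}(y:A)$ is the least length $|p|$ of a program $p$ with this oracle such that (C1) for every word $y'$, of any length, $p(y')$ halts within $t(|y'|)$ steps; (C2) for every word $y'$, $p(y')$ is $1$ or $\bot$; (C3) for every $y'\in\{0,1\}^n$, $p(y')=1$ implies $y'\in A$ (and $p(y')=0$ implies $y'\notin A$); (C4) if $y\in A$ then $p(y)=1$. **Theorem.** For every such $f$ there are a computable and constructible time bound $t$ (constructible: $t(n)$ is the exact running time on $n$ of some program without oracle) and a constant $c$ such that for all $n$ $$\Bigl|\,N^1(f_n)-\max_{x,y\in\{0,1\}^n}\mathrm{ic}_{\mathrm{yes}}^{f,t}\bigl(y:Y_1(x)\bigr)\Bigr|\le c .$$ -/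

import Mathlib

/-! ### Non-deterministic communication protocols

Outputs (of protocols and of programs) live in `Option Bool`:
`some true` is `1`, `some false` is `0` and `none` is `⊥`. -/

/-- A communication protocol in which Alice holds an input in `X`, Bob holds an input in `Y`,
and each party holds a word, its part of the guess.  At an inner node one party sends one bit,
computed (without any bound on resources) from its own input and its own part of the guess;
a leaf carries the output. -/
inductive Protocol (X Y : Type) : Type
  | leaf (out : Option Bool) : Protocol X Y
  | alice (msg : X → List Bool → Bool) (next : Bool → Protocol X Y) : Protocol X Y
  | bob (msg : Y → List Bool → Bool) (next : Bool → Protocol X Y) : Protocol X Y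

namespace Protocol

variable {X Y : Type}

/-- The conversation: the sequence of bits exchanged with guess `w` on inputs `x`, `y`. -/
def conversation : Protocol X Y → List Bool × List Bool → X → Y → List Bool
  | leaf _, _, _, _ => []
  | alice msg next, w, x, y =>
      msg x w.1 :: conversation (next (msg x w.1)) w x y
  | bob msg next, w, x, y =>
      msg y w.2 :: conversation (next (msg y w.2)) w x y

/-- The output `P(w, x, y)`. -/
def output : Protocol X Y → List Bool × List Bool → X → Y → Option Bool
  | leaf out, _, _, _ => out
  | alice msg next, w, x, y => output (next (msg x w.1)) w x y
  | bob msg next, w, x, y => output (next (msg y w.2)) w x y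

/-- `P` is a one-sided non-deterministic protocol for `f` with output set `{1, ⊥}`. -/
def IsOneSided (P : Protocol X Y) (f : X → Y → Bool) : Prop :=
  (∀ w x y, P.output w x y = some true ∨ P.output w x y = none) ∧
  (∀ x y, f x y = true → ∃ w, P.output w x y = some true) ∧
  (∀ x y, f x y ≠ true → ∀ w, P.output w x y = none)

/-- The individual communication complexity of `P` with output set `{1, ⊥}`: the length of the
shortest conversation that ends with output `1`. -/
noncomputable def individualCost (P : Protocol X Y) (x : X) (y : Y) : ℕ∞ :=
  ⨅ (w : List Bool × List Bool) (_ : P.output w x y = some true),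
    ((P.conversation w x y).length : ℕ∞)

/-- The communication complexity of `P` with output set `{1, ⊥}`: the maximum of the individual
ones, which are only considered at inputs with `f x y = 1`. -/
noncomputable def cost (P : Protocol X Y) (f : X → Y → Bool) : ℕ∞ :=
  ⨆ (x : X) (y : Y) (_ : f x y = true), P.individualCost x y

end Protocol

/-- The one-sided non-deterministic communication complexity `N¹(f)`. -/
noncomputable def nondetComplexity {X Y : Type} (f : X → Y → Bool) : ℕ∞ :=
  ⨅ (P : Protocol X Y) (_ : P.IsOneSided f), P.cost f

/-! ### Oracle programs with a step count -/

namespace OracleMachine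

/-- Codes of a machine that works on lists of natural numbers (the head of the empty list
counts as `0`).  The first seven constructors are those of `Turing.ToPartrec.Code`, with the
same meaning; `query` asks the oracle.

* `zero`: `v ↦ 0 :: v`
* `succ`: `v ↦ [v.head + 1]`
* `tail`: `v ↦ v.tail`
* `cons f fs`: `v ↦ (f v).head :: fs v`
* `comp f g`: `v ↦ f (g v)`
* `case f g`: `0 :: v ↦ f v` and `(n + 1) :: v ↦ g (n :: v)`
* `fix f`: `v ↦ u.tail` if `u = f v` has head `0`, otherwise start again with `u.tail`
* `query`: `v ↦ [O v.head]`, where `O` is the oracle -/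
inductive Code : Type
  | zero : Code
  | succ : Code
  | tail : Code
  | cons (f fs : Code) : Code
  | comp (f g : Code) : Code
  | case (f g : Code) : Code
  | fix (f : Code) : Code
  | query : Code

/-- The serialization of a code: each constructor is written with three bits, in preorder. -/
def Code.bits : Code → List Bool
  | zero => [false, false, false]
  | succ => [false, false, true]
  | tail => [false, true, false]
  | cons f fs => [false, true, true] ++ (f.bits ++ fs.bits)
  | comp f g => [true, false, false] ++ (f.bits ++ g.bits)
  | case f g => [true, false, true] ++ (f.bits ++ g.bits)
  | fix f => [true, true, false] ++ f.bits
  | query => [true, true, true]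

/-- The serialization is self-delimiting: a word starts with at most one code. -/
theorem Code.bits_append_inj : ∀ (c d : Code) {u v : List Bool},
    c.bits ++ u = d.bits ++ v → c = d ∧ u = v := by
  intro c
  induction c with
  | zero => intro d u v h; cases d <;> simp_all [Code.bits]
  | succ => intro d u v h; cases d <;> simp_all [Code.bits]
  | tail => intro d u v h; cases d <;> simp_all [Code.bits]
  | query => intro d u v h; cases d <;> simp_all [Code.bits]
  | fix f ih =>
    intro d u v h
    cases d <;> simp [Code.bits] at h ⊢
    exact ih _ h
  | cons f g ihf ihg =>
    intro d u v h
    cases d <;> simp [Code.bits] at h ⊢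
    obtain ⟨h1, h2⟩ := ihf _ h
    obtain ⟨h3, h4⟩ := ihg _ h2
    exact ⟨⟨h1, h3⟩, h4⟩
  | comp f g ihf ihg =>
    intro d u v h
    cases d <;> simp [Code.bits] at h ⊢
    obtain ⟨h1, h2⟩ := ihf _ h
    obtain ⟨h3, h4⟩ := ihg _ h2
    exact ⟨⟨h1, h3⟩, h4⟩
  | case f g ihf ihg =>
    intro d u v h
    cases d <;> simp [Code.bits] at h ⊢
    obtain ⟨h1, h2⟩ := ihf _ h
    obtain ⟨h3, h4⟩ := ihg _ h2
    exact ⟨⟨h1, h3⟩, h4⟩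

/-- Continuations: the control stack of the machine. -/
inductive Cont : Type
  | halt : Cont
  | consHead (fs : Code) (v : List ℕ) (k : Cont) : Cont
  | consTail (a : ℕ) (k : Cont) : Cont
  | comp (f : Code) (k : Cont) : Cont
  | fix (f : Code) (k : Cont) : Cont

/-- Configurations: either the machine starts to run a code on a list, or it has just obtained
a list and hands it to the continuation. -/
inductive Cfg : Type
  | run (c : Code) (v : List ℕ) (k : Cont) : Cfg
  | ret (k : Cont) (v : List ℕ) : Cfg

/-- One step of the machine with oracle `O`.  The halted configurations `ret halt v` are the
fixed points. -/
def step (O : ℕ → ℕ) : Cfg → Cfg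
  | .run .zero v k => .ret k (0 :: v)
  | .run .succ v k => .ret k [v.headI + 1]
  | .run .tail v k => .ret k v.tail
  | .run (.cons f fs) v k => .run f v (.consHead fs v k)
  | .run (.comp f g) v k => .run g v (.comp f k)
  | .run (.case f g) v k =>
      match v.headI with
      | 0 => .run f v.tail k
      | n + 1 => .run g (n :: v.tail) k
  | .run (.fix f) v k => .run f v (.fix f k)
  | .run .query v k => .ret k [O v.headI]
  | .ret .halt v => .ret .halt v
  | .ret (.consHead fs v k) u => .run fs v (.consTail u.headI k)
  | .ret (.consTail a k) u => .ret k (a :: u)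
  | .ret (.comp f k) u => .run f u k
  | .ret (.fix f k) u => if u.headI = 0 then .ret k u.tail else .run f u.tail (.fix f k)

/-- Started with code `c` on the list `v`, the machine halts within `s` steps with result `r`. -/
def HaltsWithin (O : ℕ → ℕ) (c : Code) (v : List ℕ) (s : ℕ) (r : List ℕ) : Prop :=
  (step O)^[s] (.run c v .halt) = .ret .halt r

/-- A time bound is constructible if some program, without an oracle, halts on the
number `n` after exactly `t n` steps, for every `n`. -/
def Constructible (t : ℕ → ℕ) : Prop :=
  ∃ c : Code, ∀ n, (∃ r, HaltsWithin (fun _ => 0) c [n] (t n) r) ∧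
    ∀ s < t n, ∀ r, ¬ HaltsWithin (fun _ => 0) c [n] s r

/-- The number with binary expansion `1w`. -/
def wordNum (w : List Bool) : ℕ := w.foldl (fun a b => 2 * a + b.toNat) 1

/-- The number with binary expansion `1y`. -/
def inputNum {n : ℕ} (y : BitVec n) : ℕ := 2 ^ n + y.toNat

/-- The number that stands for an output. -/
def outNum : Option Bool → ℕ
  | some false => 0
  | some true => 1
  | none => 2

/-- The program `p`, a word, halts on the word `y` within `s` steps with result `r`.  A program
is a code followed by an arbitrary word `w` of data; the machine is started with
`1y` and `1w`. -/
def ProgHaltsWithin (O : ℕ → ℕ) (p : List Bool) {n : ℕ} (y : BitVec n) (s : ℕ)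
    (r : List ℕ) : Prop :=
  ∃ (c : Code) (w : List Bool), p = c.bits ++ w ∧
    HaltsWithin O c [inputNum y, wordNum w] s r

/-- `p(y)` runs in time not exceeding `s`. -/
def RunsInTime (O : ℕ → ℕ) (p : List Bool) {n : ℕ} (y : BitVec n) (s : ℕ) : Prop :=
  ∃ r, ProgHaltsWithin O p y s r

/-- `p(y) = o`. -/
def Outputs (O : ℕ → ℕ) (p : List Bool) {n : ℕ} (y : BitVec n) (o : Option Bool) : Prop :=
  ∃ s, ProgHaltsWithin O p y s [outNum o]

/-- `p` is consistent with the set `A` of words of length `n`. -/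
def Consistent (O : ℕ → ℕ) (p : List Bool) {n : ℕ} (A : Set (BitVec n)) : Prop :=
  ∀ y : BitVec n, (Outputs O p y (some true) → y ∈ A) ∧ (Outputs O p y (some false) → y ∉ A)

/-- `p` satisfies the four conditions for the `t`-bounded inside instance complexity of `x`
relative to `A`.  The first two concern the inputs of every length. -/
structure Corresponds (O : ℕ → ℕ) (t : ℕ → ℕ) {n : ℕ} (x : BitVec n) (A : Set (BitVec n))
    (p : List Bool) : Prop where
  time : ∀ (m : ℕ) (y : BitVec m), RunsInTime O p y (t m)
  out : ∀ (m : ℕ) (y : BitVec m), Outputs O p y (some true) ∨ Outputs O p y none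
  consistent : Consistent O p A
  inside : x ∈ A → Outputs O p x (some true)

/-- The `t`-bounded inside instance complexity `ic_yes^{O,t}(x : A)`. -/
noncomputable def icYes (O : ℕ → ℕ) (t : ℕ → ℕ) {n : ℕ} (x : BitVec n)
    (A : Set (BitVec n)) : ℕ∞ :=
  ⨅ (p : List Bool) (_ : Corresponds O t x A p), (p.length : ℕ∞)

/-- The oracle that on query `n` answers with the truth table of `f` at length `n`, read as a
binary number: the bit at position `i * 2 ^ n + j` is the value of `f` at the `i`-th and the
`j`-th word of length `n`. -/
def descr (f : (n : ℕ) → BitVec n → BitVec n → Bool) (n : ℕ) : ℕ :=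
  ∑ i ∈ Finset.range (2 ^ n), ∑ j ∈ Finset.range (2 ^ n),
    if f n (BitVec.ofNat n i) (BitVec.ofNat n j) then 2 ^ (i * 2 ^ n + j) else 0

end OracleMachine

/-- `Y₁(x)`, the set of all `y` with `f(x, y) = 1`. -/
def Y₁ {X Y : Type} (f : X → Y → Bool) (x : X) : Set Y := {y | f x y = true}

namespace OracleMachine

/-! ### Exact step counts of the machine -/

/-- `b` is reached from `a` after exactly `s` steps, none of which starts in a halted
configuration. -/
def Reaches (O : ℕ → ℕ) (a : Cfg) (s : ℕ) (b : Cfg) : Prop :=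
  (step O)^[s] a = b ∧ ∀ s' < s, ∀ r, (step O)^[s'] a ≠ .ret .halt r

/-- In every context, `c` evaluates on `v` to `r` in exactly `s` steps. -/
def Evaluates (O : ℕ → ℕ) (c : Code) (v : List ℕ) (s : ℕ) (r : List ℕ) : Prop :=
  ∀ k, Reaches O (.run c v k) s (.ret k r)

variable {O : ℕ → ℕ}

theorem Reaches.refl (a : Cfg) : Reaches O a 0 a := ⟨rfl, by simp⟩

theorem Reaches.head {a b : Cfg} {s : ℕ} (ha : ∀ r, a ≠ .ret .halt r)
    (h : Reaches O (step O a) s b) : Reaches O a (s + 1) b := by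
  refine ⟨h.1, fun s' hs' r => ?_⟩
  cases s' with
  | zero => exact ha r
  | succ s' => exact h.2 s' (by omega) r

theorem Reaches.trans {a b d : Cfg} {s₁ s₂ : ℕ} (h₁ : Reaches O a s₁ b)
    (h₂ : Reaches O b s₂ d) : Reaches O a (s₁ + s₂) d := by
  refine ⟨by rw [add_comm, Function.iterate_add_apply, h₁.1, h₂.1], fun s' hs' r => ?_⟩
  by_cases h : s' < s₁
  · exact h₁.2 s' h r
  · obtain ⟨j, rfl⟩ := Nat.exists_eq_add_of_le (not_lt.1 h)
    rw [add_comm, Function.iterate_add_apply, h₁.1]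
    exact h₂.2 j (by omega) r

theorem Evaluates.of_eq {c : Code} {v r : List ℕ} {s s' : ℕ} (h : Evaluates O c v s r)
    (hs : s = s') : Evaluates O c v s' r := hs ▸ h

theorem Evaluates.zero (v : List ℕ) : Evaluates O .zero v 1 (0 :: v) :=
  fun _ => .head (by simp) (.refl _)

theorem Evaluates.succ (v : List ℕ) : Evaluates O .succ v 1 [v.headI + 1] :=
  fun _ => .head (by simp) (.refl _)

theorem Evaluates.tail (v : List ℕ) : Evaluates O .tail v 1 v.tail :=
  fun _ => .head (by simp) (.refl _)

theorem Evaluates.query (v : List ℕ) : Evaluates O .query v 1 [O v.headI] :=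
  fun _ => .head (by simp) (.refl _)

theorem Evaluates.cons {f fs : Code} {v u u' : List ℕ} {s₁ s₂ : ℕ}
    (h₁ : Evaluates O f v s₁ u) (h₂ : Evaluates O fs v s₂ u') :
    Evaluates O (.cons f fs) v (s₁ + s₂ + 3) (u.headI :: u') := fun k => by
  have h := Reaches.head (a := .run (.cons f fs) v k) (by simp) <|
    (h₁ (.consHead fs v k)).trans <|
    .head (by simp) <| (h₂ (.consTail u.headI k)).trans <| .head (by simp) (.refl _)
  convert h using 1
  · omega
  · rfl

theorem Evaluates.comp {f g : Code} {v u u' : List ℕ} {s₁ s₂ : ℕ}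
    (h₁ : Evaluates O g v s₁ u) (h₂ : Evaluates O f u s₂ u') :
    Evaluates O (.comp f g) v (s₁ + s₂ + 2) u' := fun k => by
  have h := Reaches.head (a := .run (.comp f g) v k) (by simp) <|
    (h₁ (.comp f k)).trans <| .head (by simp) (h₂ k)
  convert h using 1
  omega

theorem Evaluates.case_zero {f g : Code} {v r : List ℕ} {s : ℕ} (hv : v.headI = 0)
    (h : Evaluates O f v.tail s r) : Evaluates O (.case f g) v (s + 1) r := fun k => by
  refine .head (by simp) ?_
  simp only [step, hv]
  exact h k

theorem Evaluates.case_succ {f g : Code} {v r : List ℕ} {s n : ℕ} (hv : v.headI = n + 1)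
    (h : Evaluates O g (n :: v.tail) s r) : Evaluates O (.case f g) v (s + 1) r := fun k => by
  refine .head (by simp) ?_
  simp only [step, hv]
  exact h k

theorem Evaluates.fix_done {f : Code} {v u : List ℕ} {s : ℕ} (h : Evaluates O f v s u)
    (hu : u.headI = 0) : Evaluates O (.fix f) v (s + 2) u.tail := fun k => by
  have h' : Reaches O (.ret (.fix f k) u) 1 (.ret k u.tail) :=
    .head (by simp) (by simpa [step, hu] using .refl _)
  convert (show Reaches O (.run (.fix f) v k) _ _ from
    Reaches.head (by simp) ((h (.fix f k)).trans h')) using 1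

theorem Evaluates.fix_continue {f : Code} {v u r : List ℕ} {s s' : ℕ}
    (h : Evaluates O f v s u) (hu : u.headI ≠ 0) (h' : Evaluates O (.fix f) u.tail s' r) :
    Evaluates O (.fix f) v (s + s' + 1) r := fun k => by
  -- The first step of `h'` only pushes the loop continuation. A repeated round skips it, going
  -- straight to the body.
  obtain ⟨s', rfl⟩ : ∃ m, s' = m + 1 := by
    cases s' with
    | zero => have := (h' k).1; simp at this
    | succ m => exact ⟨m, rfl⟩
  have h₂ : Reaches O (.run f u.tail (.fix f k)) s' (.ret k r) := by
    refine ⟨(h' k).1, fun j hj => (h' k).2 (j + 1) (by omega)⟩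
  have h₃ : Reaches O (.ret (.fix f k) u) (s' + 1) (.ret k r) :=
    .head (by simp) (by simpa [step, hu] using h₂)
  convert (show Reaches O (.run (.fix f) v k) _ _ from
    Reaches.head (by simp) ((h (.fix f k)).trans h₃)) using 1

theorem Evaluates.haltsWithin {c : Code} {v r : List ℕ} {s : ℕ} (h : Evaluates O c v s r) :
    HaltsWithin O c v s r := (h .halt).1

theorem iterate_step_halt (r : List ℕ) (s : ℕ) :
    (step O)^[s] (.ret .halt r) = .ret .halt r :=
  Function.iterate_fixed rfl s

theorem HaltsWithin.mono {c : Code} {v r : List ℕ} {s s' : ℕ} (h : HaltsWithin O c v s r)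
    (hs : s ≤ s') : HaltsWithin O c v s' r := by
  obtain ⟨j, rfl⟩ := Nat.exists_eq_add_of_le hs
  rw [HaltsWithin, add_comm, Function.iterate_add_apply, show (step O)^[s] _ = _ from h,
    iterate_step_halt]

theorem HaltsWithin.unique {c : Code} {v r r' : List ℕ} {s s' : ℕ} (h : HaltsWithin O c v s r)
    (h' : HaltsWithin O c v s' r') : r = r' := by
  have h₁ := h.mono (le_max_left s s')
  rw [HaltsWithin, show (step O)^[max s s'] _ = _ from h'.mono (le_max_right s s')] at h₁
  simpa using h₁.symm

/-! ### Codes without queries -/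

/-- The query-free code with the same constructors. -/
def Code.ofToPartrec : Turing.ToPartrec.Code → Code
  | .zero' => .zero
  | .succ => .succ
  | .tail => .tail
  | .cons f fs => .cons (ofToPartrec f) (ofToPartrec fs)
  | .comp f g => .comp (ofToPartrec f) (ofToPartrec g)
  | .case f g => .case (ofToPartrec f) (ofToPartrec g)
  | .fix f => .fix (ofToPartrec f)

/-- One round of a `fix` loop whose body evaluates as `e`; the second component counts steps. -/
def timedLoop (e : List ℕ →. List ℕ × ℕ) (p : List ℕ × ℕ) :
    Part (List ℕ × ℕ ⊕ List ℕ × ℕ) :=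
  (e p.1).map fun q =>
    if q.1.headI = 0 then .inl (q.1.tail, p.2 + q.2 + 1) else .inr (q.1.tail, p.2 + q.2 + 1)

/-- The result of a query-free code together with the number of steps it takes. -/
def timedEval : Turing.ToPartrec.Code → List ℕ →. List ℕ × ℕ
  | .zero' => fun v => Part.some (0 :: v, 1)
  | .succ => fun v => Part.some ([v.headI + 1], 1)
  | .tail => fun v => Part.some (v.tail, 1)
  | .cons f fs => fun v => (timedEval f v).bind fun p =>
      (timedEval fs v).map fun q => (p.1.headI :: q.1, p.2 + q.2 + 3)
  | .comp f g => fun v => (timedEval g v).bind fun p =>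
      (timedEval f p.1).map fun q => (q.1, p.2 + q.2 + 2)
  | .case f g => fun v =>
      (Nat.casesOn (motive := fun _ => Part (List ℕ × ℕ)) v.headI (timedEval f v.tail)
        fun y => timedEval g (y :: v.tail)).map fun p => (p.1, p.2 + 1)
  -- The counter starts at `1` for the step that enters the loop.
  | .fix f => fun v => PFun.fix (timedLoop (timedEval f)) (v, 1)

theorem partrec_timedLoop {e : List ℕ →. List ℕ × ℕ} (he : Partrec e) :
    Partrec (timedLoop e) := by
  refine (he.comp Computable.fst).map ?_
  have h1 : Primrec fun x : (List ℕ × ℕ) × (List ℕ × ℕ) =>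
      (x.2.1.tail, x.1.2 + x.2.2 + 1) :=
    .pair (Primrec.list_tail.comp (Primrec.fst.comp .snd))
      (Primrec.succ.comp (Primrec.nat_add.comp (Primrec.snd.comp .fst) (Primrec.snd.comp .snd)))
  exact (Primrec.ite (Primrec.eq.comp (Primrec.list_headI.comp (Primrec.fst.comp .snd)) (.const 0))
    (Primrec.sumInl.comp h1) (Primrec.sumInr.comp h1)).to_comp

theorem partrec_timedEval (c : Turing.ToPartrec.Code) : Partrec (timedEval c) := by
  induction c with
  | zero' => exact ((Primrec.list_cons.comp (.const 0) .id).pair (.const 1)).to_comp.partrec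
  | succ =>
    exact ((Primrec.list_cons.comp (Primrec.succ.comp Primrec.list_headI) (.const [])).pair
      (.const 1)).to_comp.partrec
  | tail => exact (Primrec.list_tail.pair (.const 1)).to_comp.partrec
  | cons f fs ihf ihfs =>
    refine ihf.bind ((ihfs.comp Computable.fst).map ?_)
    exact ((Primrec.list_cons.comp
        (Primrec.list_headI.comp (Primrec.fst.comp (Primrec.snd.comp .fst)))
        (Primrec.fst.comp .snd)).pair
      (Primrec.nat_add.comp (Primrec.nat_add.comp (Primrec.snd.comp (Primrec.snd.comp .fst))
        (Primrec.snd.comp .snd)) (.const 3))).to_comp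
  | comp f g ihf ihg =>
    refine ihg.bind ((ihf.comp (Computable.fst.comp .snd)).map ?_)
    exact ((Primrec.fst.comp .snd).pair
      (Primrec.nat_add.comp (Primrec.nat_add.comp (Primrec.snd.comp (Primrec.snd.comp .fst))
        (Primrec.snd.comp .snd)) (.const 2))).to_comp
  | case f g ihf ihg =>
    have h0 : Computable fun v : List ℕ => decide (v.headI = 0) :=
      (Primrec.eq.comp Primrec.list_headI (.const 0)).decide.to_comp
    have h := Partrec.cond h0 (ihf.comp Primrec.list_tail.to_comp)
      (ihg.comp (Primrec.list_cons.comp (Primrec.pred.comp Primrec.list_headI)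
        Primrec.list_tail).to_comp)
    refine Partrec.map (h.of_eq fun v => ?_)
      ((Primrec.fst.comp .snd).pair (Primrec.succ.comp (Primrec.snd.comp .snd))).to_comp
    rcases v.headI with _ | n <;> rfl
  | fix f ih =>
    exact (Partrec.fix (partrec_timedLoop ih)).comp (Computable.id.pair (.const 1))

theorem evaluates_of_mem_timedEval (c : Turing.ToPartrec.Code) :
    ∀ {v r : List ℕ} {s : ℕ}, (r, s) ∈ timedEval c v →
      Evaluates O (Code.ofToPartrec c) v s r := by
  induction c with
  | zero' => intro v r s h; simp [timedEval] at h; obtain ⟨rfl, rfl⟩ := h; exact .zero v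
  | succ => intro v r s h; simp [timedEval] at h; obtain ⟨rfl, rfl⟩ := h; exact .succ v
  | tail => intro v r s h; simp [timedEval] at h; obtain ⟨rfl, rfl⟩ := h; exact .tail v
  | cons f fs ihf ihfs =>
    intro v r s h
    simp only [timedEval, Part.mem_bind_iff, Part.mem_map_iff, Prod.mk.injEq] at h
    obtain ⟨p, hp, q, hq, rfl, rfl⟩ := h
    exact (ihf hp).cons (ihfs hq)
  | comp f g ihf ihg =>
    intro v r s h
    simp only [timedEval, Part.mem_bind_iff, Part.mem_map_iff, Prod.mk.injEq] at h
    obtain ⟨p, hp, q, hq, rfl, rfl⟩ := h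
    exact (ihg hp).comp (ihf hq)
  | case f g ihf ihg =>
    intro v r s h
    simp only [timedEval, Part.mem_map_iff, Prod.mk.injEq] at h
    obtain ⟨p, hp, rfl, rfl⟩ := h
    rcases hv : v.headI with _ | n
    · rw [hv] at hp; exact .case_zero hv (ihf hp)
    · rw [hv] at hp; exact .case_succ hv (ihg hp)
  | fix f ih =>
    intro v r s h
    -- The step that enters the loop is counted both in `p.2` and in `m`, whence `s + 1`.
    have key : ∀ p : List ℕ × ℕ, (r, s) ∈ PFun.fix (timedLoop (timedEval f)) p →
        ∃ m, s + 1 = p.2 + m ∧ Evaluates O (.fix (Code.ofToPartrec f)) p.1 m r := by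
      intro p hp
      refine PFun.fixInduction' (C := fun p => ∃ m, s + 1 = p.2 + m ∧
        Evaluates O (.fix (Code.ofToPartrec f)) p.1 m r) hp ?_ ?_
      · intro p hp
        simp only [timedLoop, Part.mem_map_iff] at hp
        obtain ⟨q, hq, h⟩ := hp
        split_ifs at h with h0
        simp only [Sum.inl.injEq, Prod.mk.injEq] at h
        obtain ⟨rfl, rfl⟩ := h
        exact ⟨_, by omega, (ih hq).fix_done h0⟩
      · intro p p' _ hp ⟨m, hm, hE⟩
        simp only [timedLoop, Part.mem_map_iff] at hp
        obtain ⟨q, hq, h⟩ := hp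
        split_ifs at h with h0
        simp only [Sum.inr.injEq] at h
        subst h
        exact ⟨_, by simp only at hm; omega, (ih hq).fix_continue h0 hE⟩
    obtain ⟨m, hm, hE⟩ := key _ h
    exact hE.of_eq (by simp only at hm; omega)

theorem exists_mem_timedEval (c : Turing.ToPartrec.Code) :
    ∀ {v r : List ℕ}, r ∈ c.eval v → ∃ s, (r, s) ∈ timedEval c v := by
  induction c with
  | zero' => intro v r h; simp [timedEval] at h ⊢; exact h
  | succ => intro v r h; simp [timedEval] at h ⊢; exact h
  | tail => intro v r h; simp [timedEval] at h ⊢; exact h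
  | cons f fs ihf ihfs =>
    intro v r h
    simp only [Turing.ToPartrec.Code.cons_eval, Part.bind_eq_bind, Part.mem_bind_iff,
      Part.pure_eq_some, Part.mem_some_iff] at h
    obtain ⟨a, ha, b, hb, rfl⟩ := h
    obtain ⟨s₁, h₁⟩ := ihf ha
    obtain ⟨s₂, h₂⟩ := ihfs hb
    simp only [timedEval, Part.mem_bind_iff, Part.mem_map_iff]
    exact ⟨_, _, h₁, _, h₂, rfl⟩
  | comp f g ihf ihg =>
    intro v r h
    rw [Turing.ToPartrec.Code.comp_eval] at h
    obtain ⟨a, ha, hb⟩ := Part.mem_bind_iff.1 h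
    obtain ⟨s₁, h₁⟩ := ihg ha
    obtain ⟨s₂, h₂⟩ := ihf hb
    simp only [timedEval, Part.mem_bind_iff, Part.mem_map_iff]
    exact ⟨_, _, h₁, _, h₂, rfl⟩
  | case f g ihf ihg =>
    intro v r h
    simp only [Turing.ToPartrec.Code.case_eval] at h
    simp only [timedEval, Part.mem_map_iff]
    rcases hv : v.headI with _ | n
    · rw [hv] at h
      obtain ⟨s, hs⟩ := ihf h
      exact ⟨_, _, hs, rfl⟩
    · rw [hv] at h
      obtain ⟨s, hs⟩ := ihg h
      exact ⟨_, _, hs, rfl⟩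
  | fix f ih =>
    intro v r h
    simp only [Turing.ToPartrec.Code.fix_eval] at h
    -- The counter has to be arbitrary for the induction, as it changes from round to round.
    suffices ∀ a, ∃ s, (r, s) ∈ PFun.fix (timedLoop (timedEval f)) (v, a) from this 1
    refine PFun.fixInduction' (C := fun v => ∀ a, ∃ s,
      (r, s) ∈ PFun.fix (timedLoop (timedEval f)) (v, a)) h ?_ ?_
    · intro v hv a
      simp only [Part.mem_map_iff] at hv
      obtain ⟨u, hu, h⟩ := hv
      split_ifs at h with h0
      simp only [Sum.inl.injEq] at h
      subst h
      obtain ⟨s, hs⟩ := ih hu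
      exact ⟨a + s + 1, PFun.fix_stop (by
        simp only [timedLoop, Part.mem_map_iff]; exact ⟨_, hs, by simp [h0]⟩)⟩
    · intro v v' _ hv IH a
      simp only [Part.mem_map_iff] at hv
      obtain ⟨u, hu, h⟩ := hv
      split_ifs at h with h0
      simp only [Sum.inr.injEq] at h
      subst h
      obtain ⟨s, hs⟩ := ih hu
      obtain ⟨s', hs'⟩ := IH (a + s + 1)
      refine ⟨s', PFun.mem_fix_iff.2 (.inr ⟨_, ?_, hs'⟩)⟩
      simp only [timedLoop, Part.mem_map_iff]; exact ⟨_, hs, by simp [h0]⟩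

/-- The step count is computable because `timedEval` is partial recursive and converges wherever the
code does. Without queries the count is the same for all oracles. -/
theorem exists_code_evaluates {n : ℕ} {f : List.Vector ℕ n → ℕ} (hf : Computable f) :
    ∃ (c : Code) (τ : List.Vector ℕ n → ℕ), Computable τ ∧
      ∀ O v, Evaluates O c v.toList (τ v) [f v] := by
  obtain ⟨c, hc⟩ := Turing.ToPartrec.Code.exists_code (Nat.Partrec'.of_part hf.partrec)
  have hmem (v : List.Vector ℕ n) : ∃ s, ([f v], s) ∈ timedEval c v.toList := by
    apply exists_mem_timedEval
    have := hc v
    simp only [PFun.coe_val, Part.map_eq_map, Part.map_some] at this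
    rw [show v.toList = v.1 from rfl, this]
    exact Part.mem_some _
  choose τ hτ using hmem
  refine ⟨.ofToPartrec c, τ, ?_, fun O v => evaluates_of_mem_timedEval c (hτ v)⟩
  have h : Partrec fun v : List.Vector ℕ n => (timedEval c v.toList).map Prod.snd :=
    ((partrec_timedEval c).comp Primrec.vector_toList.to_comp).map (Computable.snd.comp .snd)
  refine h.of_eq fun v => ?_
  rw [Part.eq_some_iff.2 (hτ v)]
  simp

/-! ### Numbers grow by at most one per step -/

/-- All numbers stored in the continuation are at most `m`. -/
def Cont.Bounded (m : ℕ) : Cont → Prop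
  | .halt => True
  | .consHead _ v k => (∀ x ∈ v, x ≤ m) ∧ k.Bounded m
  | .consTail a k => a ≤ m ∧ k.Bounded m
  | .comp _ k => k.Bounded m
  | .fix _ k => k.Bounded m

/-- All numbers stored in the configuration are at most `m`. -/
def Cfg.Bounded (m : ℕ) : Cfg → Prop
  | .run _ v k => (∀ x ∈ v, x ≤ m) ∧ k.Bounded m
  | .ret k v => (∀ x ∈ v, x ≤ m) ∧ k.Bounded m

theorem Cont.Bounded.mono {m m' : ℕ} (h : m ≤ m') {k : Cont} (hk : k.Bounded m) :
    k.Bounded m' := by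
  induction k with
  | halt => trivial
  | consHead fs v k ih => exact ⟨fun x hx => (hk.1 x hx).trans h, ih hk.2⟩
  | consTail a k ih => exact ⟨hk.1.trans h, ih hk.2⟩
  | comp f k ih => exact ih hk
  | fix f k ih => exact ih hk

theorem headI_le_of_forall_le {v : List ℕ} {m : ℕ} (h : ∀ x ∈ v, x ≤ m) : v.headI ≤ m := by
  cases v with
  | nil => exact Nat.zero_le m
  | cons a l => exact h a (by simp)

/-- Only `succ` can exceed the numbers already present, since the oracle here answers `0`. -/
theorem Cfg.Bounded.step {m : ℕ} {a : Cfg} (h : a.Bounded m) :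
    (step (fun _ => 0) a).Bounded (m + 1) := by
  have mono {v : List ℕ} (hv : ∀ x ∈ v, x ≤ m) : ∀ x ∈ v, x ≤ m + 1 :=
    fun x hx => (hv x hx).trans m.le_succ
  have tail {v : List ℕ} (hv : ∀ x ∈ v, x ≤ m) : ∀ x ∈ v.tail, x ≤ m + 1 :=
    fun x hx => mono hv x (List.mem_of_mem_tail hx)
  have kmono {k : Cont} (hk : k.Bounded m) : k.Bounded (m + 1) := hk.mono m.le_succ
  cases a with
  | run c v k =>
    obtain ⟨hv, hk⟩ := h
    have h0 := headI_le_of_forall_le hv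
    cases c with
    | zero => exact ⟨by simpa using mono hv, kmono hk⟩
    | succ => exact ⟨by simpa using h0, kmono hk⟩
    | tail => exact ⟨tail hv, kmono hk⟩
    | cons f fs => exact ⟨mono hv, mono hv, kmono hk⟩
    | comp f g => exact ⟨mono hv, kmono hk⟩
    | fix f => exact ⟨mono hv, kmono hk⟩
    | query => exact ⟨by simp, kmono hk⟩
    | case f g =>
      simp only [OracleMachine.step]
      split
      · exact ⟨tail hv, kmono hk⟩
      · refine ⟨?_, kmono hk⟩
        simp only [List.mem_cons, forall_eq_or_imp]
        exact ⟨by omega, tail hv⟩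
  | ret k v =>
    obtain ⟨hv, hk⟩ := h
    have h0 := headI_le_of_forall_le hv
    cases k with
    | halt => exact ⟨mono hv, trivial⟩
    | consHead fs w k => exact ⟨mono hk.1, by omega, kmono hk.2⟩
    | consTail b k =>
      refine ⟨?_, kmono hk.2⟩
      simp only [List.mem_cons, forall_eq_or_imp]
      exact ⟨hk.1.trans m.le_succ, mono hv⟩
    | comp f k => exact ⟨mono hv, kmono hk⟩
    | fix f k =>
      simp only [OracleMachine.step]
      split
      · exact ⟨tail hv, kmono hk⟩
      · exact ⟨tail hv, kmono hk⟩

theorem Cfg.Bounded.iterate_step {m : ℕ} {a : Cfg} (h : a.Bounded m) (s : ℕ) :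
    ((OracleMachine.step (fun _ => 0))^[s] a).Bounded (m + s) := by
  induction s with
  | zero => exact h
  | succ s ih =>
    rw [Function.iterate_succ_apply']
    exact ih.step

/-- Take for `t` the running time of a code for `n ↦ T n + n`: starting from `n`, at least `T n`
steps are needed to produce so large a number. -/
theorem exists_constructible_ge {T : ℕ → ℕ} (hT : Computable T) :
    ∃ t : ℕ → ℕ, Computable t ∧ Constructible t ∧ ∀ n, T n ≤ t n := by
  have hf : Computable fun v : List.Vector ℕ 1 => T v.head + v.head :=
    Primrec.nat_add.to_comp.comp (hT.comp Primrec.vector_head.to_comp) Primrec.vector_head.to_comp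
  obtain ⟨c, τ, hτ, hc⟩ := exists_code_evaluates hf
  refine ⟨fun n => τ (n ::ᵥ .nil),
    hτ.comp (Primrec.vector_cons.comp .id (.const _)).to_comp, ⟨c, fun n => ?_⟩, fun n => ?_⟩
  · have h := hc (fun _ => 0) (n ::ᵥ .nil)
    exact ⟨⟨_, h.haltsWithin⟩, (h .halt).2⟩
  · have h : HaltsWithin _ c [n] _ _ := (hc (fun _ => 0) (n ::ᵥ .nil)).haltsWithin
    have hb : (Cfg.run c [n] .halt).Bounded n := ⟨by simp, trivial⟩
    have h' := hb.iterate_step (τ (n ::ᵥ .nil))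
    rw [show _ = Cfg.ret _ _ from h] at h'
    have := h'.1 _ (List.mem_singleton_self _)
    simp only [List.Vector.head_cons] at this
    exact Nat.le_of_add_le_add_right (this.trans_eq (add_comm _ _))

/-! ### Maxima of computable functions -/

/-- A sum of `τ` over all triples whose code is below a computable bound dominates each term. -/
theorem exists_computable_bound {τ : ℕ × ℕ × ℕ → ℕ} (hτ : Computable τ) {B : ℕ → ℕ}
    (hB : Computable B) :
    ∃ T : ℕ → ℕ, Computable T ∧
      ∀ n a b d, a < B n → b < B n → d < B n → τ (a, b, d) ≤ T n := by
  let g : ℕ → ℕ := fun m => τ (m.unpair.1, m.unpair.2.unpair)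
  have hg : Computable g := hτ.comp
    ((Primrec.fst.comp .unpair).pair (Primrec.unpair.comp (Primrec.snd.comp .unpair))).to_comp
  let S : ℕ → ℕ := fun m => Nat.rec 0 (fun i s => s + g i) m
  have hS : Computable S := Computable.nat_rec .id (.const 0)
    (Primrec.nat_add.to_comp.comp (Computable.snd.comp .snd)
      (hg.comp (Computable.fst.comp .snd))).to₂
  have hmono : ∀ m i, i < m → g i ≤ S m := by
    intro m
    induction m with
    | zero => intro i hi; omega
    | succ m ih =>
      intro i hi
      change g i ≤ S m + g m
      rcases Nat.lt_succ_iff_lt_or_eq.1 hi with h | rfl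
      · exact (ih i h).trans (Nat.le_add_right _ _)
      · exact Nat.le_add_left _ _
  have hP : Primrec₂ fun a b : ℕ => (a + b + 1) * (a + b + 1) := by
    have : Primrec₂ fun a b : ℕ => a + b + 1 := Primrec.succ.comp₂ Primrec.nat_add
    exact Primrec.nat_mul.comp₂ this this
  have hpair (a b : ℕ) : Nat.pair a b < (a + b + 1) * (a + b + 1) := by
    have h := Nat.pair_lt_max_add_one_sq a b
    have h' : max a b + 1 ≤ a + b + 1 := by omega
    exact h.trans_le ((Nat.pow_le_pow_left h' 2).trans_eq (sq _))
  let P : ℕ → ℕ → ℕ := fun a b => (a + b + 1) * (a + b + 1)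
  have hPm {a b a' b' : ℕ} (h : a ≤ a') (h' : b ≤ b') : P a b ≤ P a' b' := by
    have : a + b + 1 ≤ a' + b' + 1 := by omega
    exact Nat.mul_le_mul this this
  refine ⟨fun n => S (P (B n) (P (B n) (B n))),
    hS.comp (hP.to_comp.comp hB (hP.to_comp.comp hB hB)), fun n a b d ha hb hd => ?_⟩
  have h := hmono (P (B n) (P (B n) (B n))) (Nat.pair a (Nat.pair b d)) ?_
  · simpa [g] using h
  · exact (hpair _ _).trans_le (hPm ha.le ((hpair _ _).le.trans (hPm hb.le hd.le)))

/-! ### The main program -/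

namespace Code

/-- `v ↦ []` -/
def nil : Code := .comp .tail .succ

/-- `v ↦ v` -/
def id : Code := .comp .tail .zero

/-- `v ↦ [v.headI]` -/
def head : Code := .cons id nil

/-- Truncated subtraction, by decrementing both numbers until one of them is `0`: the running time
is bounded in terms of the first one. -/
def sub : Code := .fix <| .case (.comp .zero .zero) <|
  .comp (.case (.comp .zero .succ) (.cons (.comp .succ .zero) (.cons .tail id))) (.cons .tail id)

end Code

theorem Evaluates.nil (v : List ℕ) : Evaluates O .nil v 4 [] := (Evaluates.succ v).comp (.tail _)

theorem Evaluates.id (v : List ℕ) : Evaluates O .id v 4 v := (Evaluates.zero v).comp (.tail _)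

theorem Evaluates.head (v : List ℕ) : Evaluates O .head v 11 [v.headI] :=
  (Evaluates.id v).cons (.nil v)

/-- Every round lowers `a` at constant cost, so `b` does not affect the bound. Rounds leave old
entries behind the new pair, hence the arbitrary `l` and the claim about the head of `r` only. -/
theorem exists_evaluates_sub (a b : ℕ) (l : List ℕ) :
    ∃ s ≤ 40 * (a + 1), ∃ r, Evaluates O .sub (a :: b :: l) s r ∧ r.headI = a - b := by
  induction a generalizing b l with
  | zero =>
    refine ⟨_, ?_, _, .fix_done (.case_zero rfl ((Evaluates.zero _).comp (.zero _))) rfl, ?_⟩ <;>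
      simp
  | succ a ih =>
    have hdup (b : ℕ) : Evaluates O (.cons .tail .id) (a :: b :: l) _ _ :=
      (Evaluates.tail _).cons (.id _)
    cases b with
    | zero =>
      refine ⟨_, ?_, _, .fix_done (.case_succ rfl <| (hdup 0).comp
        (.case_zero rfl ((Evaluates.succ _).comp (.zero _)))) rfl, ?_⟩
      · omega
      · simp
    | succ b =>
      obtain ⟨s, hs, r, hr, h⟩ := ih b (a :: (b + 1) :: l)
      refine ⟨_, ?_, _, .fix_continue (.case_succ rfl <| (hdup (b + 1)).comp
        (.case_succ rfl (((Evaluates.zero _).comp (.succ _)).cons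
          ((Evaluates.tail _).cons (.id _))))) (by simp) hr, ?_⟩
      · omega
      · omega

/-- For computable `N` and `G` there is a code that computes
`[y, w] ↦ [G (O (N y)) y (y - w)]` in time bounded computably in `O (N y)`, `y` and `y - w`. -/
theorem exists_code_query {N : ℕ → ℕ} (hN : Computable N) {G : ℕ × ℕ × ℕ → ℕ}
    (hG : Computable G) :
    ∃ (c : Code) (τ : ℕ × ℕ × ℕ → ℕ), Computable τ ∧ ∀ (O : ℕ → ℕ) (y w : ℕ),
      ∃ s ≤ τ (O (N y), y, y - w), Evaluates O c [y, w] s [G (O (N y), y, y - w)] := by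
  obtain ⟨cN, τN, hτN, hcN⟩ := exists_code_evaluates (n := 1) (f := fun v => N v.head)
    (hN.comp Primrec.vector_head.to_comp)
  have hget (i : Fin 3) : Computable fun v : List.Vector ℕ 3 => v.get i :=
    (Primrec.vector_get.comp .id (.const i)).to_comp
  obtain ⟨cG, τG, hτG, hcG⟩ := exists_code_evaluates (n := 3)
    (f := fun v => G (v.get 0, v.get 1, v.get 2))
    (hG.comp ((hget 0).pair ((hget 1).pair (hget 2))))
  -- The number `w` is touched only by `sub`; `40 * (y + 1)` pays for that, and `100` for the
  -- plumbing.
  refine ⟨.comp cG (.cons (.comp .query (.comp cN .head)) (.cons .head (.cons .sub .nil))),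
    fun p => τN (p.2.1 ::ᵥ .nil) + τG (p.1 ::ᵥ p.2.1 ::ᵥ p.2.2 ::ᵥ .nil) +
      40 * (p.2.1 + 1) + 100, ?_, fun O y w => ?_⟩
  · have h1 : Primrec fun p : ℕ × ℕ × ℕ => (p.2.1 ::ᵥ .nil : List.Vector ℕ 1) :=
      Primrec.vector_cons.comp (Primrec.fst.comp .snd) (.const _)
    have h3 : Primrec fun p : ℕ × ℕ × ℕ =>
        (p.1 ::ᵥ p.2.1 ::ᵥ p.2.2 ::ᵥ .nil : List.Vector ℕ 3) :=
      Primrec.vector_cons.comp .fst (Primrec.vector_cons.comp (Primrec.fst.comp .snd)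
        (Primrec.vector_cons.comp (Primrec.snd.comp .snd) (.const _)))
    have h4 : Primrec fun p : ℕ × ℕ × ℕ => 40 * (p.2.1 + 1) :=
      Primrec.nat_mul.comp (.const 40) (Primrec.succ.comp (Primrec.fst.comp .snd))
    have add {f g : ℕ × ℕ × ℕ → ℕ} (hf : Computable f) (hg : Computable g) :
        Computable fun p => f p + g p := Primrec.nat_add.to_comp.comp hf hg
    exact add (add (add (hτN.comp h1.to_comp) (hτG.comp h3.to_comp)) h4.to_comp) (.const 100)
  · obtain ⟨s, hs, r, hr, h⟩ := exists_evaluates_sub (O := O) y w []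
    have e1 := ((Evaluates.head (O := O) [y, w]).comp (hcN O (y ::ᵥ .nil))).comp (.query _)
    have e2 := e1.cons ((Evaluates.head _).cons (hr.cons (.nil _)))
    have hl : (O (N y) ::ᵥ y ::ᵥ (y - w) ::ᵥ .nil : List.Vector ℕ 3).toList
        = [O (N y), y, r.headI] := by rw [h]; rfl
    have e3 := hcG O (O (N y) ::ᵥ y ::ᵥ (y - w) ::ᵥ .nil)
    rw [hl] at e3
    exact ⟨_, by simp only; omega, e2.comp e3⟩

end OracleMachine

/-! ### Primitive recursion: bounded quantifiers and binary digits -/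

theorem PrimrecRel.forall_lt_comp {α : Type*} [Primcodable α] {R : ℕ → α → Prop}
    (hR : PrimrecRel R) {f : α → ℕ} (hf : Primrec f) :
    PrimrecPred fun a => ∀ x < f a, R x a :=
  (hR.forall_mem_list.comp (Primrec.list_range.comp hf) .id).of_eq (by simp)

theorem PrimrecRel.exists_lt_comp {α : Type*} [Primcodable α] {R : ℕ → α → Prop}
    (hR : PrimrecRel R) {f : α → ℕ} (hf : Primrec f) :
    PrimrecPred fun a => ∃ x < f a, R x a :=
  (hR.exists_mem_list.comp (Primrec.list_range.comp hf) .id).of_eq (by simp)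

theorem Primrec.nat_two_pow : Primrec fun n : ℕ => 2 ^ n :=
  (Primrec.nat_rec₁ 1 (Primrec.nat_mul.comp (.const 2) .snd).to₂).of_eq fun n => by
    induction n with
    | zero => rfl
    | succ n ih => simp only [ih, pow_succ]; ring

theorem PrimrecRel.testBit : PrimrecRel fun m i : ℕ => m.testBit i = true :=
  (Primrec.eq.comp (Primrec.nat_mod.comp (Primrec.nat_div.comp .fst
    (Primrec.nat_two_pow.comp .snd)) (.const 2)) (.const 1)).of_eq fun p => by
      simp [Nat.testBit_eq_decide_div_mod_eq]

namespace OracleMachine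

/-! ### Covers coded as numbers -/

/-- The bits of `F` describe an `N × N` matrix, those of `E` the rows of a `0`-`1` matrix with
`N` columns, that is, a family of sets: every `1` at `(x, y)` in `F` is covered by a set in the
family that contains `y` and contains only positions of `1`s in row `x`. -/
def Covers (N F E : ℕ) : Prop :=
  ∀ x < N, ∀ y < N, F.testBit (x * N + y) = true →
    -- The bound makes the search for `i` finite and excludes nothing: a `1` at position `i * N + y`
    -- forces `i ≤ E`.
    ∃ i < E + 1, E.testBit (i * N + y) = true ∧
      ∀ z < N, E.testBit (i * N + z) = true → F.testBit (x * N + z) = true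

/-- Built from the inside out: `h1` is the quantifier-free kernel, and each later stage closes one
bounded quantifier. The tuple `q` holds the variables still free. -/
theorem primrecRel_covers : PrimrecRel fun (p : ℕ × ℕ) (E : ℕ) => Covers p.1 p.2 E := by
  have idx {α : Type} [Primcodable α] {a b c : α → ℕ} (ha : Primrec a) (hb : Primrec b)
      (hc : Primrec c) : Primrec fun q => a q * b q + c q :=
    Primrec.nat_add.comp (Primrec.nat_mul.comp ha hb) hc
  have h1 : PrimrecRel fun (z : ℕ) (q : ℕ × ℕ × ℕ × (ℕ × ℕ) × ℕ) =>
      (¬ q.2.2.2.2.testBit (q.1 * q.2.2.2.1.1 + z) = true) ∨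
        q.2.2.2.1.2.testBit (q.2.2.1 * q.2.2.2.1.1 + z) = true := by
    have hE : Primrec fun r : ℕ × ℕ × ℕ × ℕ × (ℕ × ℕ) × ℕ => r.2.2.2.2.2 :=
      Primrec.snd.comp (Primrec.snd.comp (Primrec.snd.comp (Primrec.snd.comp .snd)))
    have hp : Primrec fun r : ℕ × ℕ × ℕ × ℕ × (ℕ × ℕ) × ℕ => r.2.2.2.2.1 :=
      Primrec.fst.comp (Primrec.snd.comp (Primrec.snd.comp (Primrec.snd.comp .snd)))
    have hx : Primrec fun r : ℕ × ℕ × ℕ × ℕ × (ℕ × ℕ) × ℕ => r.2.2.2.1 :=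
      Primrec.fst.comp (Primrec.snd.comp (Primrec.snd.comp .snd))
    exact (PrimrecRel.testBit.comp hE
      (idx (Primrec.fst.comp .snd) (Primrec.fst.comp hp) .fst)).not.or
      (PrimrecRel.testBit.comp (Primrec.snd.comp hp) (idx hx (Primrec.fst.comp hp) .fst))
  have h2 : PrimrecRel fun (i : ℕ) (q : ℕ × ℕ × (ℕ × ℕ) × ℕ) =>
      q.2.2.2.testBit (i * q.2.2.1.1 + q.1) = true ∧
      ∀ z < q.2.2.1.1, (¬ q.2.2.2.testBit (i * q.2.2.1.1 + z) = true) ∨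
        q.2.2.1.2.testBit (q.2.1 * q.2.2.1.1 + z) = true := by
    have hE : Primrec fun r : ℕ × ℕ × ℕ × (ℕ × ℕ) × ℕ => r.2.2.2.2 :=
      Primrec.snd.comp (Primrec.snd.comp (Primrec.snd.comp .snd))
    have hN : Primrec fun r : ℕ × ℕ × ℕ × (ℕ × ℕ) × ℕ => r.2.2.2.1.1 :=
      Primrec.fst.comp (Primrec.fst.comp (Primrec.snd.comp (Primrec.snd.comp .snd)))
    exact (PrimrecRel.testBit.comp hE (idx .fst hN (Primrec.fst.comp .snd))).and
      (h1.forall_lt_comp hN)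
  have h3 : PrimrecRel fun (y : ℕ) (q : ℕ × (ℕ × ℕ) × ℕ) =>
      (¬ q.2.1.2.testBit (q.1 * q.2.1.1 + y) = true) ∨ ∃ i < q.2.2 + 1,
      q.2.2.testBit (i * q.2.1.1 + y) = true ∧
      ∀ z < q.2.1.1, (¬ q.2.2.testBit (i * q.2.1.1 + z) = true) ∨
        q.2.1.2.testBit (q.1 * q.2.1.1 + z) = true := by
    have hE : Primrec fun r : ℕ × ℕ × (ℕ × ℕ) × ℕ => r.2.2.2 :=
      Primrec.snd.comp (Primrec.snd.comp .snd)
    have hp : Primrec fun r : ℕ × ℕ × (ℕ × ℕ) × ℕ => r.2.2.1 :=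
      Primrec.fst.comp (Primrec.snd.comp .snd)
    exact (PrimrecRel.testBit.comp (Primrec.snd.comp hp)
      (idx (Primrec.fst.comp .snd) (Primrec.fst.comp hp) .fst)).not.or
      (h2.exists_lt_comp (Primrec.succ.comp hE))
  have h4 : PrimrecRel fun (x : ℕ) (q : (ℕ × ℕ) × ℕ) => ∀ y < q.1.1,
      (¬ q.1.2.testBit (x * q.1.1 + y) = true) ∨ ∃ i < q.2 + 1,
      q.2.testBit (i * q.1.1 + y) = true ∧
      ∀ z < q.1.1, (¬ q.2.testBit (i * q.1.1 + z) = true) ∨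
        q.1.2.testBit (x * q.1.1 + z) = true :=
    h3.forall_lt_comp (Primrec.fst.comp (Primrec.fst.comp .snd))
  refine (h4.forall_lt_comp (Primrec.fst.comp .fst)).of_eq fun q => ?_
  simp only [Covers, imp_iff_not_or]

theorem exists_testBit_family (K N : ℕ) (p : ℕ → ℕ → Bool) :
    ∃ E < 2 ^ (K * N), ∀ i, ∀ y < N, E.testBit (i * N + y) = (decide (i < K) && p i y) := by
  refine ⟨Nat.ofBits fun m : Fin (K * N) => p (m / N) (m % N), Nat.ofBits_lt_two_pow _,
    fun i y hy => ?_⟩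
  have h1 : (i * N + y) / N = i := by
    rw [mul_comm, Nat.mul_add_div (by omega), Nat.div_eq_of_lt hy, add_zero]
  have h2 : (i * N + y) % N = y := by
    rw [mul_comm, Nat.mul_add_mod, Nat.mod_eq_of_lt hy]
  by_cases hi : i < K
  · rw [Nat.testBit_ofBits_lt _ _ (by
      calc i * N + y < (i + 1) * N := by rw [add_mul]; omega
        _ ≤ K * N := Nat.mul_le_mul_right N hi)]
    simp [h1, h2, hi]
  · rw [Nat.testBit_ofBits_ge _ _ (le_add_right (Nat.mul_le_mul_right N (not_lt.1 hi)))]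
    simp [hi]

/-- This turns minimality of a code into minimality of a family: if some cover has `K` sets, all
nonempty sets of the least cover have numbers below `K`. -/
theorem lt_of_testBit_eq_true {E K N i y : ℕ} (hE : E < 2 ^ (K * N))
    (h : E.testBit (i * N + y) = true) : i < K := by
  by_contra hi
  have h1 : K * N ≤ i * N := Nat.mul_le_mul_right N (not_lt.1 hi)
  have h2 : 2 ^ (K * N) ≤ 2 ^ (i * N + y) := Nat.pow_le_pow_right (by norm_num) (by omega)
  have := Nat.ge_two_pow_of_testBit h
  omega

theorem exists_covers_lt {K N F : ℕ} (p : ℕ → ℕ → Bool)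
    (hp : ∀ x < N, ∀ y < N, F.testBit (x * N + y) = true →
      ∃ i < K, p i y = true ∧ ∀ z < N, p i z = true → F.testBit (x * N + z) = true) :
    ∃ E < 2 ^ (K * N), Covers N F E := by
  obtain ⟨E, hE, h⟩ := exists_testBit_family K N p
  refine ⟨E, hE, fun x hx y hy hF => ?_⟩
  obtain ⟨i, hi, hy', hz⟩ := hp x hx y hy hF
  have hEi : E.testBit (i * N + y) = true := by simp [h i y hy, hi, hy']
  refine ⟨i, ?_, hEi, fun z hz' hEz => hz z hz' ?_⟩
  · have h1 := Nat.ge_two_pow_of_testBit hEi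
    have h2 : i * N + y < 2 ^ (i * N + y) := Nat.lt_two_pow_self
    have h3 : i ≤ i * N := Nat.le_mul_of_pos_right i (by omega)
    omega
  · rw [h i z hz'] at hEz
    simp_all

/-- The singletons form a cover. -/
theorem exists_covers_lt_self (N F : ℕ) : ∃ E < 2 ^ (N * N), Covers N F E :=
  exists_covers_lt (fun i y => decide (i = y)) fun x _ y hy h =>
    ⟨y, hy, by simp, fun z _ hz => by simp only [decide_eq_true_eq] at hz; exact hz ▸ h⟩

open Classical in
/-- The least number that describes a cover; it has the least number of sets. -/
noncomputable def leastCover (N F : ℕ) : ℕ :=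
  Nat.find (p := Covers N F) ((exists_covers_lt_self N F).imp fun _ h => h.2)

theorem covers_leastCover (N F : ℕ) : Covers N F (leastCover N F) := by
  classical exact Nat.find_spec (p := Covers N F) _

theorem leastCover_le {N F E : ℕ} (h : Covers N F E) : leastCover N F ≤ E := by
  classical exact Nat.find_min' (p := Covers N F) _ h

open Classical in
theorem computable_leastCover : Computable₂ leastCover := by
  have h : Computable₂ fun (p : ℕ × ℕ) (E : ℕ) => decide (Covers p.1 p.2 E) :=
    (PrimrecPred.decide primrecRel_covers).to_comp
  refine (Partrec.rfind h.partrec₂).of_eq_tot fun p => ?_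
  rw [Nat.mem_rfind]
  refine ⟨by simpa using covers_leastCover p.1 p.2, fun {m} hm => ?_⟩
  simpa using fun hc => (leastCover_le hc).not_gt hm

/-! ### The function computed by the main program -/

/-- The exponent of the leading binary digit. -/
def leadingExponent (Y : ℕ) : ℕ := Nat.findGreatest (fun k => 2 ^ k ≤ Y) Y

theorem primrec_leadingExponent : Primrec leadingExponent :=
  Primrec.nat_findGreatest .id (Primrec.nat_le.comp (Primrec.nat_two_pow.comp .snd) .fst)

theorem leadingExponent_two_pow_add {n y : ℕ} (hy : y < 2 ^ n) :
    leadingExponent (2 ^ n + y) = n := by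
  rw [leadingExponent, Nat.findGreatest_eq_iff]
  refine ⟨?_, fun _ => by omega, fun m hm _ h => ?_⟩
  · have : n < 2 ^ n := Nat.lt_two_pow_self
    omega
  · have : 2 ^ (n + 1) ≤ 2 ^ m := Nat.pow_le_pow_right (by norm_num) hm
    rw [pow_succ] at this
    omega

/-- The function computed by the main program from the truth table `F`, the number `1y` and the
truncated difference of `1y` and `1w`: whether `y` lies in the set with number `1w - 1` of the
least cover. -/
noncomputable def coverOutput (q : ℕ × ℕ × ℕ) : ℕ :=
  bif (leastCover (2 ^ leadingExponent q.2.1) q.1).testBit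
    -- Subtracting the truncated difference from `1y` gives the minimum of `1y` and `1w`. Sets are
    -- numbered from `0`, words from `1`.
    ((q.2.1 - q.2.2 - 1) * 2 ^ leadingExponent q.2.1 + (q.2.1 - 2 ^ leadingExponent q.2.1))
  then 1 else 2

theorem computable_bif_testBit {α : Type*} [Primcodable α] {m i : α → ℕ} (hm : Computable m)
    (hi : Computable i) : Computable fun q => bif (m q).testBit (i q) then 1 else 2 := by
  have ht : Computable₂ fun m i : ℕ => m.testBit i :=
    (PrimrecRel.testBit.decide.of_eq fun q => by simp).to_comp
  exact Computable.cond (ht.comp hm hi) (.const 1) (.const 2)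

theorem primrec_index {α : Type*} [Primcodable α] {w N y : α → ℕ} (hw : Primrec w)
    (hN : Primrec N) (hy : Primrec y) : Primrec fun q => w q * N q + (y q - N q) :=
  Primrec.nat_add.comp (Primrec.nat_mul.comp hw hN) (Primrec.nat_sub.comp hy hN)

theorem computable_coverOutput : Computable coverOutput := by
  have hY : Primrec fun q : ℕ × ℕ × ℕ => q.2.1 := Primrec.fst.comp .snd
  have hN : Primrec fun q : ℕ × ℕ × ℕ => 2 ^ leadingExponent q.2.1 :=
    Primrec.nat_two_pow.comp (primrec_leadingExponent.comp hY)
  have hw : Primrec fun q : ℕ × ℕ × ℕ => q.2.1 - q.2.2 - 1 :=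
    Primrec.nat_sub.comp (Primrec.nat_sub.comp hY (Primrec.snd.comp .snd)) (.const 1)
  exact computable_bif_testBit (computable_leastCover.comp hN.to_comp .fst)
    (primrec_index hw hN hY).to_comp

end OracleMachine

/-! ### Protocols and covers -/

theorem ENat.exists_of_iInf₂_le {ι : Type*} {p : ι → Prop} {g : ι → ℕ∞} {k : ℕ}
    (h : ⨅ (i) (_ : p i), g i ≤ k) : ∃ i, p i ∧ g i ≤ k := by
  have h' : ⨅ (i) (_ : p i), g i < (k : ℕ∞) + 1 := (ENat.lt_add_one_iff (by simp)).2 h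
  simp only [iInf_lt_iff] at h'
  obtain ⟨i, hi, hlt⟩ := h'
  exact ⟨i, hi, (ENat.lt_add_one_iff (by simp)).1 hlt⟩

namespace Protocol

variable {X Y : Type}

/-- The first `m` bits of a word, filled up with zeros. -/
def firstBits (m : ℕ) (w : List Bool) : List Bool := (List.range m).map (w.getD · false)

theorem firstBits_length (w : List Bool) : firstBits w.length w = w := by
  apply List.ext_getElem <;> simp +contextual [firstBits]

/-- Alice sends the first `m` bits of her guess. -/
def sendGuess : ℕ → (List Bool → Protocol X Y) → Protocol X Y
  | 0, next => next []
  -- Bits are sent from the last to the first; appending `b` behind the later ones restores their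
  -- order.
  | m + 1, next => alice (fun _ w => w.getD m false) fun b => sendGuess m fun v => next (v ++ [b])

theorem output_sendGuess (m : ℕ) (next : List Bool → Protocol X Y) (w : List Bool × List Bool)
    (x : X) (y : Y) :
    (sendGuess m next).output w x y = (next (firstBits m w.1)).output w x y := by
  induction m generalizing next with
  | zero => rfl
  | succ m ih => simp [sendGuess, output, ih, firstBits, List.range_succ]

theorem length_conversation_sendGuess (m : ℕ) (next : List Bool → Protocol X Y)
    (w : List Bool × List Bool) (x : X) (y : Y) :
    ((sendGuess m next).conversation w x y).length =
      m + ((next (firstBits m w.1)).conversation w x y).length := by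
  induction m generalizing next with
  | zero => simp [sendGuess, firstBits]
  | succ m ih =>
    simp only [sendGuess, conversation, ih, firstBits, List.range_succ, List.length_cons,
      List.map_append, List.map_cons, List.map_nil]
    omega

open Classical in
/-- Alice sends the first `m` bits of her guess, the number of a set, provided that the set
contains only solutions; Bob tells whether his input lies in the set. -/
noncomputable def coverProtocol (f : X → Y → Bool) (m : ℕ) (B : List Bool → Set Y) :
    Protocol X Y :=
  alice (fun x w => decide (B (firstBits m w) ⊆ Y₁ f x)) fun a =>
    bif a then sendGuess m fun v => bob (fun y _ => decide (y ∈ B v)) fun b =>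
      leaf (bif b then some true else none)
    else leaf none

open Classical in
theorem output_coverProtocol (f : X → Y → Bool) (m : ℕ) (B : List Bool → Set Y)
    (w : List Bool × List Bool) (x : X) (y : Y) :
    (coverProtocol f m B).output w x y =
      if B (firstBits m w.1) ⊆ Y₁ f x ∧ y ∈ B (firstBits m w.1) then some true else none := by
  by_cases h1 : B (firstBits m w.1) ⊆ Y₁ f x <;> by_cases h2 : y ∈ B (firstBits m w.1) <;>
    simp [coverProtocol, output, output_sendGuess, h1, h2]

theorem length_conversation_coverProtocol_le (f : X → Y → Bool) (m : ℕ) (B : List Bool → Set Y)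
    (w : List Bool × List Bool) (x : X) (y : Y) :
    ((coverProtocol f m B).conversation w x y).length ≤ m + 2 := by
  by_cases h1 : B (firstBits m w.1) ⊆ Y₁ f x <;>
    simp [coverProtocol, conversation, length_conversation_sendGuess, h1]

/-- The rectangle property of conversations. -/
theorem output_eq_of_conversation_eq (P : Protocol X Y) {w w' : List Bool × List Bool}
    {x x' : X} {y y' : Y} (h : P.conversation w x y = P.conversation w' x' y') :
    P.output (w.1, w'.2) x y' = P.output w x y := by
  induction P with
  | leaf out => rfl
  | alice msg next ih =>
    simp only [conversation, List.cons.injEq] at h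
    obtain ⟨h1, h2⟩ := h
    rw [← h1] at h2
    exact ih _ h2
  | bob msg next ih =>
    simp only [conversation, List.cons.injEq] at h
    obtain ⟨h1, h2⟩ := h
    rw [← h1] at h2
    simp only [output, ← h1]
    exact ih _ h2

/-- The inputs of Bob that admit the conversation `v` with output `1`. -/
def acceptedBy (P : Protocol X Y) (v : List Bool) : Set Y :=
  {y | ∃ w x, P.conversation w x y = v ∧ P.output w x y = some true}

/-- Take `v` to be a shortest accepting conversation on `(x, y)`. If `y'` admits `v` as well,
exchanging Bob's side makes `P` output `1` on `(x, y')`, so `f x y' = 1`. -/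
theorem exists_acceptedBy_subset {P : Protocol X Y} {f : X → Y → Bool} (hP : P.IsOneSided f)
    {k : ℕ} (hk : P.cost f ≤ k) {x : X} {y : Y} (h : f x y = true) :
    ∃ v : List Bool, v.length ≤ k ∧ y ∈ P.acceptedBy v ∧ P.acceptedBy v ⊆ Y₁ f x := by
  have h1 : P.individualCost x y ≤ k :=
    (le_iSup_of_le x <| le_iSup_of_le y <|
      le_iSup (fun _ : f x y = true => P.individualCost x y) h).trans hk
  obtain ⟨w, hw, hlen⟩ := ENat.exists_of_iInf₂_le h1
  refine ⟨P.conversation w x y, by exact_mod_cast hlen, ⟨w, x, rfl, hw⟩, ?_⟩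
  rintro y' ⟨w', x', hc, -⟩
  have h2 := P.output_eq_of_conversation_eq hc.symm
  by_contra hf
  rw [hP.2.2 x y' hf, hw] at h2
  simp at h2

end Protocol

/-- Alice's inclusion test makes the protocol sound for any `B`. Her test and Bob's answer are the
two extra bits. -/
theorem nondetComplexity_le_of_cover {X Y : Type} {f : X → Y → Bool} {m : ℕ}
    {B : List Bool → Set Y}
    (h : ∀ x y, f x y = true → ∃ v : List Bool, v.length = m ∧ y ∈ B v ∧ B v ⊆ Y₁ f x) :
    nondetComplexity f ≤ m + 2 := by
  have hex (x : X) (y : Y) (hf : f x y = true) :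
      ∃ w, (Protocol.coverProtocol f m B).output w x y = some true := by
    obtain ⟨v, rfl, hy, hB⟩ := h x y hf
    refine ⟨(v, []), ?_⟩
    rw [Protocol.output_coverProtocol, if_pos]
    rw [Protocol.firstBits_length]
    exact ⟨hB, hy⟩
  refine iInf₂_le_of_le (Protocol.coverProtocol f m B) ⟨fun w x y => ?_, hex, ?_⟩ ?_
  · rw [Protocol.output_coverProtocol]
    split_ifs <;> simp
  · intro x y hf w
    rw [Protocol.output_coverProtocol, if_neg]
    exact fun ⟨h1, h2⟩ => hf (h1 h2)
  · refine iSup_le fun x => iSup_le fun y => iSup_le fun hf => ?_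
    obtain ⟨w, hw⟩ := hex x y hf
    refine iInf₂_le_of_le w hw ?_
    exact_mod_cast Protocol.length_conversation_coverProtocol_le f m B w x y

namespace OracleMachine

/-! ### Words and numbers -/

theorem wordNum_append_singleton (w : List Bool) (b : Bool) :
    wordNum (w ++ [b]) = 2 * wordNum w + b.toNat := by
  simp [wordNum]

theorem two_pow_length_le_wordNum (w : List Bool) : 2 ^ w.length ≤ wordNum w := by
  induction w using List.reverseRecOn with
  | nil => simp [wordNum]
  | append_singleton w b ih =>
    rw [wordNum_append_singleton, List.length_append, List.length_singleton, pow_succ]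
    omega

theorem wordNum_lt (w : List Bool) : wordNum w < 2 ^ (w.length + 1) := by
  induction w using List.reverseRecOn with
  | nil => simp [wordNum]
  | append_singleton w b ih =>
    rw [wordNum_append_singleton, List.length_append, List.length_singleton, pow_succ]
    have := b.toNat_lt
    omega

theorem wordNum_injective : Function.Injective wordNum := by
  intro w
  induction w using List.reverseRecOn with
  | nil =>
    intro w' h
    have h1 := two_pow_length_le_wordNum w'
    rw [← h, show wordNum [] = 1 from rfl] at h1
    by_contra hne
    have h2 : 0 < w'.length := List.length_pos_iff.2 (Ne.symm hne)
    have := Nat.one_lt_two_pow h2.ne'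
    omega
  | append_singleton w b ih =>
    intro w' h
    induction w' using List.reverseRecOn with
    | nil =>
      have h1 := two_pow_length_le_wordNum (w ++ [b])
      rw [h, show wordNum [] = 1 from rfl, List.length_append, List.length_singleton,
        pow_succ] at h1
      have := Nat.two_pow_pos w.length
      omega
    | append_singleton w' b' =>
      rw [wordNum_append_singleton, wordNum_append_singleton] at h
      have := b.toNat_lt
      have := b'.toNat_lt
      have hb : b.toNat = b'.toNat := by omega
      rw [ih (by omega : wordNum w = wordNum w')]
      cases b <;> cases b' <;> simp_all

theorem exists_wordNum_eq {m : ℕ} (hm : 1 ≤ m) : ∃ w, wordNum w = m := by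
  induction m using Nat.strong_induction_on with
  | _ m ih =>
    rcases hm.eq_or_lt with rfl | h
    · exact ⟨[], rfl⟩
    · obtain ⟨w, hw⟩ := ih (m / 2) (by omega) (by omega)
      refine ⟨w ++ [decide (m % 2 = 1)], ?_⟩
      rw [wordNum_append_singleton, hw]
      rcases Nat.mod_two_eq_zero_or_one m with h2 | h2 <;> simp [h2] <;> omega

/-! ### The truth table -/

/-- The `r i` are digits in base `2 ^ N`. Used with single bits to form a row and with rows to form
the table. -/
theorem sum_mul_two_pow_lt_and_testBit {N M : ℕ} {r : ℕ → ℕ} (hr : ∀ i < M, r i < 2 ^ N) :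
    ∑ i ∈ Finset.range M, r i * 2 ^ (i * N) < 2 ^ (M * N) ∧
      ∀ i < M, ∀ j < N, (∑ i ∈ Finset.range M, r i * 2 ^ (i * N)).testBit (i * N + j) =
        (r i).testBit j := by
  induction M with
  | zero => simp
  | succ M ih =>
    obtain ⟨h1, h2⟩ := ih fun i hi => hr i (by omega)
    rw [Finset.sum_range_succ, add_comm, mul_comm (r M)]
    refine ⟨?_, fun i hi j hj => ?_⟩
    · have h3 : r M + 1 ≤ 2 ^ N := hr M (by omega)
      calc _ < 2 ^ (M * N) * (r M + 1) := by rw [mul_add]; omega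
        _ ≤ 2 ^ (M * N) * 2 ^ N := Nat.mul_le_mul_left _ h3
        _ = 2 ^ ((M + 1) * N) := by rw [← pow_add]; ring_nf
    · rw [Nat.testBit_two_pow_mul_add _ h1]
      rcases Nat.lt_succ_iff_lt_or_eq.1 hi with h | rfl
      · rw [if_pos, h2 i h j hj]
        calc i * N + j < (i + 1) * N := by rw [add_mul]; omega
          _ ≤ M * N := Nat.mul_le_mul_right N h
      · rw [if_neg (by omega), Nat.add_sub_cancel_left]

theorem descr_lt_and_testBit (f : (n : ℕ) → BitVec n → BitVec n → Bool) (n : ℕ) :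
    descr f n < 2 ^ (2 ^ n * 2 ^ n) ∧ ∀ i < 2 ^ n, ∀ j < 2 ^ n,
      (descr f n).testBit (i * 2 ^ n + j) = f n (BitVec.ofNat n i) (BitVec.ofNat n j) := by
  let b (i j : ℕ) : ℕ := (f n (BitVec.ofNat n i) (BitVec.ofNat n j)).toNat
  have hb (i j : ℕ) : b i j < 2 ^ 1 := Bool.toNat_lt _
  have hrow (i : ℕ) := sum_mul_two_pow_lt_and_testBit (M := 2 ^ n) fun j _ => hb i j
  have hd : descr f n = ∑ i ∈ Finset.range (2 ^ n),
      (∑ j ∈ Finset.range (2 ^ n), b i j * 2 ^ (j * 1)) * 2 ^ (i * 2 ^ n) := by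
    refine Finset.sum_congr rfl fun i _ => ?_
    rw [Finset.sum_mul]
    refine Finset.sum_congr rfl fun j _ => ?_
    rcases hf : f n (BitVec.ofNat n i) (BitVec.ofNat n j) <;> simp [b, hf, pow_add, mul_comm]
  have h := sum_mul_two_pow_lt_and_testBit (M := 2 ^ n) (N := 2 ^ n) fun i _ => by
    simpa only [mul_one] using (hrow i).1
  simp only [mul_one] at hd h
  rw [hd]
  refine ⟨h.1, fun i hi j hj => ?_⟩
  rw [h.2 i hi j hj]
  have := (hrow i).2 j hj 0 one_pos
  simp only [mul_one, add_zero] at this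
  rw [this]
  rcases hf : f n (BitVec.ofNat n i) (BitVec.ofNat n j) <;> simp [b, hf]

/-! ### Programs -/

theorem progHaltsWithin_append {O : ℕ → ℕ} {c : Code} {w : List Bool} {n : ℕ} {y : BitVec n}
    {s : ℕ} {r : List ℕ} : ProgHaltsWithin O (c.bits ++ w) y s r ↔
      HaltsWithin O c [inputNum y, wordNum w] s r := by
  refine ⟨?_, fun h => ⟨c, w, rfl, h⟩⟩
  rintro ⟨c', w', h, hs⟩
  obtain ⟨rfl, rfl⟩ := Code.bits_append_inj _ _ h
  exact hs

/-- A program computing a total function with values `1` and `⊥` within time `t` corresponds to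
every pair with which its values are consistent. -/
theorem corresponds_of_evaluates {O t : ℕ → ℕ} {c : Code} {w : List Bool}
    {g : (m : ℕ) → BitVec m → ℕ}
    (h : ∀ m (y : BitVec m), ∃ s ≤ t m, Evaluates O c [inputNum y, wordNum w] s [g m y])
    (hg : ∀ m y, g m y = 1 ∨ g m y = 2) {n : ℕ} {x : BitVec n} {A : Set (BitVec n)}
    (hA : ∀ y, g n y = 1 → y ∈ A) (hx : x ∈ A → g n x = 1) :
    Corresponds O t x A (c.bits ++ w) := by
  have out {m : ℕ} (y : BitVec m) (o : Option Bool) :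
      Outputs O (c.bits ++ w) y o ↔ g m y = outNum o := by
    obtain ⟨s, -, hs⟩ := h m y
    simp only [Outputs, progHaltsWithin_append]
    refine ⟨fun ⟨s', h'⟩ => ?_, fun h' => ⟨s, h' ▸ hs.haltsWithin⟩⟩
    simpa using hs.haltsWithin.unique h'
  refine ⟨fun m y => ?_, fun m y => ?_, fun y => ⟨fun h' => ?_, fun h' => ?_⟩, fun h' => ?_⟩
  · obtain ⟨s, hs, he⟩ := h m y
    exact ⟨_, progHaltsWithin_append.2 (he.haltsWithin.mono hs)⟩
  · rw [out, out]
    exact hg m y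
  · exact hA y ((out y _).1 h')
  · have h1 := (out y _).1 h'
    have h2 := hg n y
    simp only [outNum] at h1
    omega
  · exact (out x _).2 (hx h')

/-- The code of the program that always outputs `⊥`. -/
def Code.bot : Code := .comp .succ (.comp .succ .nil)

theorem Evaluates.bot {O : ℕ → ℕ} (v : List ℕ) : Evaluates O .bot v 10 [2] :=
  ((Evaluates.nil v).comp (.succ _)).comp (.succ _)

theorem coverOutput_inputNum (F : ℕ) {m : ℕ} (y : BitVec m) (d : ℕ) :
    coverOutput (F, inputNum y, d) =
      bif (leastCover (2 ^ m) F).testBit ((inputNum y - d - 1) * 2 ^ m + y.toNat)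
      then 1 else 2 := by
  have h : leadingExponent (inputNum y) = m := leadingExponent_two_pow_add y.isLt
  have h' : inputNum y - 2 ^ m = y.toNat := Nat.add_sub_cancel_left ..
  simp only [coverOutput, h, h']

/-- If the positions of `1`s in the truth table `F` have a cover with `K` sets, then there is a set
with a word of length at most `log K` that contains a given position of a `1`. -/
theorem exists_word_testBit_leastCover {n F K : ℕ} (p : ℕ → ℕ → Bool)
    (hp : ∀ x < 2 ^ n, ∀ y < 2 ^ n, F.testBit (x * 2 ^ n + y) = true →
      ∃ i < 2 ^ K, p i y = true ∧
        ∀ z < 2 ^ n, p i z = true → F.testBit (x * 2 ^ n + z) = true)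
    {x y : ℕ} (hx : x < 2 ^ n) (hy : y < 2 ^ n) (h : F.testBit (x * 2 ^ n + y) = true) :
    ∃ w : List Bool, w.length ≤ K ∧ wordNum w ≤ 2 ^ n ∧
      (leastCover (2 ^ n) F).testBit ((wordNum w - 1) * 2 ^ n + y) = true ∧
      ∀ z < 2 ^ n, (leastCover (2 ^ n) F).testBit ((wordNum w - 1) * 2 ^ n + z) = true →
        F.testBit (x * 2 ^ n + z) = true := by
  obtain ⟨i, -, hi, hz⟩ := covers_leastCover (2 ^ n) F x hx y hy h
  -- The least cover is compared with two others: the given one makes the word short, and the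
  -- singletons keep its number within `2 ^ n`.
  obtain ⟨E₁, hE₁, hc₁⟩ := exists_covers_lt p hp
  obtain ⟨E₂, hE₂, hc₂⟩ := exists_covers_lt_self (2 ^ n) F
  have hiK : i < 2 ^ K := lt_of_testBit_eq_true ((leastCover_le hc₁).trans_lt hE₁) hi
  have hin : i < 2 ^ n := lt_of_testBit_eq_true ((leastCover_le hc₂).trans_lt hE₂) hi
  obtain ⟨w, hw⟩ := exists_wordNum_eq (Nat.succ_pos i)
  refine ⟨w, ?_, by omega, ?_⟩
  · have h1 := two_pow_length_le_wordNum w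
    exact (Nat.pow_le_pow_iff_right (by norm_num)).1 (h1.trans (by omega : wordNum w ≤ 2 ^ K))
  · rw [hw, Nat.succ_sub_one]
    exact ⟨hi, hz⟩

/-! ### The two inequalities -/

/-- Up to a constant, communication complexity bounds instance complexity. -/
theorem icYes_le_of_isOneSided {f : (n : ℕ) → BitVec n → BitVec n → Bool} {t : ℕ → ℕ} {c : Code}
    (hbot : ∀ m, 10 ≤ t m)
    (hc : ∀ m (y : BitVec m) (w : ℕ), ∃ s ≤ t m, Evaluates (descr f) c [inputNum y, w] s
      [coverOutput (descr f m, inputNum y, inputNum y - w)])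
    {n k : ℕ} {P : Protocol (BitVec n) (BitVec n)} (hP : P.IsOneSided (f n))
    (hk : P.cost (f n) ≤ k) (x y : BitVec n) :
    icYes (descr f) t y (Y₁ (f n) x) ≤ k + (c.bits.length + Code.bot.bits.length + 1 : ℕ) := by
  classical
  by_cases hxy : f n x y = true
  · have hF (x y : BitVec n) :
        (descr f n).testBit (x.toNat * 2 ^ n + y.toNat) = f n x y := by
      rw [(descr_lt_and_testBit f n).2 _ x.isLt _ y.isLt, BitVec.ofNat_toNat, BitVec.ofNat_toNat]
      simp
    -- Conversations of length at most `k` have numbers below `2 ^ (k + 1)`.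
    obtain ⟨w, hwk, hwn, hwy, hwz⟩ := exists_word_testBit_leastCover (n := n) (F := descr f n)
      (K := k + 1)
      (fun i z => decide (∃ v, wordNum v = i ∧ BitVec.ofNat n z ∈ P.acceptedBy v))
      (fun a ha b hb hab => by
        rw [(descr_lt_and_testBit f n).2 a ha b hb] at hab
        obtain ⟨v, hv, hbv, hsub⟩ := Protocol.exists_acceptedBy_subset hP hk hab
        refine ⟨wordNum v, (wordNum_lt v).trans_le (Nat.pow_le_pow_right (by norm_num) (by omega)),
          by simpa using ⟨v, rfl, hbv⟩, fun z hz h => ?_⟩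
        simp only [decide_eq_true_eq] at h
        obtain ⟨v', hv', hzv⟩ := h
        rw [wordNum_injective hv'] at hzv
        rw [(descr_lt_and_testBit f n).2 a ha z hz]
        exact hsub hzv) x.isLt y.isLt (by rw [hF, hxy])
    have hval (z : BitVec n) : coverOutput (descr f n, inputNum z, inputNum z - wordNum w) = 1 ↔
        (leastCover (2 ^ n) (descr f n)).testBit ((wordNum w - 1) * 2 ^ n + z.toNat) = true := by
      -- No truncation at length `n`: `1w` is at most `2 ^ n`, hence at most `1z`.
      have : inputNum z - (inputNum z - wordNum w) = wordNum w := by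
        rw [inputNum]
        omega
      rw [coverOutput_inputNum, this]
      cases (leastCover (2 ^ n) (descr f n)).testBit ((wordNum w - 1) * 2 ^ n + z.toNat) <;> simp
    refine iInf₂_le_of_le (c.bits ++ w)
      (corresponds_of_evaluates (fun m y => hc m y (wordNum w)) (fun m z => ?_) (fun z hz => ?_)
        fun _ => (hval y).2 hwy) ?_
    · rw [coverOutput_inputNum, Bool.cond_eq_ite]
      split_ifs <;> simp
    · rw [Y₁, Set.mem_ofPred_eq, ← hF]
      exact hwz _ z.isLt ((hval z).1 hz)
    · rw [List.length_append]
      norm_cast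
      omega
  -- Here `y ∉ Y₁(x)`, so never accepting is allowed.
  · refine iInf₂_le_of_le (Code.bot.bits ++ [])
      (corresponds_of_evaluates (g := fun _ _ => 2) (fun m y => ⟨10, hbot m, .bot _⟩)
        (fun _ _ => .inr rfl) (fun _ h => by simp at h) fun h => (hxy h).elim) ?_
    rw [List.append_nil]
    norm_cast
    omega

/-- The word in front of which a `1` and then zeros are written. -/
def unpad (v : List Bool) : List Bool := (v.dropWhile (!·)).tail

theorem unpad_replicate_append (a : ℕ) (p : List Bool) :
    unpad (List.replicate a false ++ true :: p) = p := by
  induction a with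
  | zero => simp [unpad]
  | succ a ih => simp_all [unpad, List.replicate_succ]

/-- Up to a constant, instance complexity bounds communication complexity. -/
theorem nondetComplexity_le_of_icYes_le {O t : ℕ → ℕ} {n L : ℕ}
    {f : BitVec n → BitVec n → Bool} (h : ∀ x y, icYes O t y (Y₁ f x) ≤ L) :
    nondetComplexity f ≤ L + 3 := by
  -- The extra bit leaves room for the marker `1` that ends the padding.
  have hcover := nondetComplexity_le_of_cover (f := f) (m := L + 1)
    (B := fun v => {y | Outputs O (unpad v) y (some true)}) fun x y hxy => by
      obtain ⟨p, hp, hlen⟩ := ENat.exists_of_iInf₂_le (h x y)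
      have hlen : p.length ≤ L := by exact_mod_cast hlen
      refine ⟨List.replicate (L - p.length) false ++ true :: p, by simp; omega, ?_, ?_⟩
      · rw [unpad_replicate_append]
        exact hp.inside hxy
      · rw [unpad_replicate_append]
        exact fun z hz => (hp.consistent z).1 hz
  refine hcover.trans (le_of_eq ?_)
  norm_cast

/-- A computable and constructible time bound that suffices for the main program with every truth
table as an oracle. -/
theorem exists_time_bound (f : (n : ℕ) → BitVec n → BitVec n → Bool) :
    ∃ t : ℕ → ℕ, Computable t ∧ Constructible t ∧ (∀ m, 10 ≤ t m) ∧
      ∃ c : Code, ∀ m (y : BitVec m) (w : ℕ), ∃ s ≤ t m,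
        Evaluates (descr f) c [inputNum y, w] s
          [coverOutput (descr f m, inputNum y, inputNum y - w)] := by
  obtain ⟨c, τ, hτ, hc⟩ := exists_code_query primrec_leadingExponent.to_comp computable_coverOutput
  -- The first summand exceeds every truth table at length `n`, the second every `1y` and thus every
  -- truncated difference.
  have hB : Computable fun n : ℕ => 2 ^ (2 ^ n * 2 ^ n) + 2 ^ (n + 1) :=
    (Primrec.nat_add.comp (Primrec.nat_two_pow.comp
      (Primrec.nat_mul.comp Primrec.nat_two_pow Primrec.nat_two_pow))
      (Primrec.nat_two_pow.comp .succ)).to_comp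
  obtain ⟨T, hT, hTτ⟩ := exists_computable_bound hτ hB
  obtain ⟨t, ht, htc, hTt⟩ := exists_constructible_ge
    (T := fun n => T n + 10) (Primrec.nat_add.to_comp.comp hT (.const 10))
  refine ⟨t, ht, htc, fun m => (Nat.le_add_left _ _).trans (hTt m), c, fun m y w => ?_⟩
  obtain ⟨s, hs, h⟩ := hc (descr f) (inputNum y) w
  have hm : leadingExponent (inputNum y) = m := leadingExponent_two_pow_add y.isLt
  rw [hm] at hs h
  refine ⟨s, hs.trans ((hTτ m _ _ _ ?_ ?_ ?_).trans ((Nat.le_add_right _ _).trans (hTt m))), h⟩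
  · exact (descr_lt_and_testBit f m).1.trans_le (Nat.le_add_right _ _)
  all_goals
    have := y.isLt
    simp only [inputNum, pow_succ]
    generalize 2 ^ (2 ^ m * 2 ^ m) = b
    omega

end OracleMachine

theorem theorem1 (f : (n : ℕ) → BitVec n → BitVec n → Bool) :
    ∃ t : ℕ → ℕ, Computable t ∧ OracleMachine.Constructible t ∧
      ∃ c : ℕ, ∀ n : ℕ,
        nondetComplexity (f n) ≤
          (⨆ (x : BitVec n) (y : BitVec n),
            OracleMachine.icYes (OracleMachine.descr f) t y (Y₁ (f n) x)) + (c : ℕ∞) ∧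
        (⨆ (x : BitVec n) (y : BitVec n),
            OracleMachine.icYes (OracleMachine.descr f) t y (Y₁ (f n) x)) ≤
          nondetComplexity (f n) + (c : ℕ∞) := by
  obtain ⟨t, ht, htc, hbot, c, hc⟩ := OracleMachine.exists_time_bound f
  -- The `3` pays for marker, test and answer in the protocol; the code lengths and one more bit pay
  -- for the programs.
  refine ⟨t, ht, htc, c.bits.length + OracleMachine.Code.bot.bits.length + 3, fun n => ⟨?_, ?_⟩⟩
  · generalize hL : (⨆ (x : BitVec n) (y : BitVec n),
      OracleMachine.icYes (OracleMachine.descr f) t y (Y₁ (f n) x)) = L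
    cases L with
    | top => simp
    | coe L =>
      refine (OracleMachine.nondetComplexity_le_of_icYes_le fun x y =>
        (le_iSup₂ (f := fun x y => OracleMachine.icYes (OracleMachine.descr f) t y (Y₁ (f n) x))
          x y).trans hL.le).trans ?_
      norm_cast
      omega
  · generalize hk : nondetComplexity (f n) = k
    cases k with
    | top => simp
    | coe k =>
      obtain ⟨P, hP, hPk⟩ := ENat.exists_of_iInf₂_le hk.le
      refine iSup₂_le fun x y =>
        (OracleMachine.icYes_le_of_isOneSided hbot hc hP hPk x y).trans ?_
      norm_cast
      omega
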